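/- Let $V$ be a finite set. For a DAG $G$ on $V$, its skeleton is obtained by forgetting the orientations, and a v-structure is a configuration $u\to v\gets w$ with $u\neq w$ not adjacent. Two DAGs on $V$ are Markov equivalent if they have the same skeleton and the same v-structures; $[G]$ is the Markov equivalence class of $G$. For $S\subseteq V$, $G_S$ is $G$ with all arcs into vertices of $S$ removed. For a set $\mathcal I$ of subsets of $V$ (interventions), let $[G]_{\mathcal I}$ be the set of all $D\in[G]$ such that $D_S$ and $G_S$ are Markov equivalent for every $S\in\mathcal I$. The $\mathcal I$-essential graph $\mathcal E_{\mathcal I}(G)$ is the partially directed graph with the skeleton of $G$ in which an edge is the arc $u\to v$ if all members of $[G]_{\mathcal I}$ orient it as $u\to v$, and is undirected if two members orient it differently. Its chain components $H\in CC(\mathcal E_{\mathcal I}(G))$ are the connected components of the undirected graph left after removing all arcs, and $\omega(H)$ is the size of a largest clique of $H$. A verifying set for $G$ is an intervention set $\mathcal I$ with $\mathcal E_{\mathcal I}(G)=G$, and $\nu_1(G)$ is the minimum size of a verifying set all of whose interventions have at most one vertex. A set $\mathcal I\subseteq V$ is identified with the atomic intervention set $\{\{v\}:v\in\mathcal I\}$.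 **Lemma.** Let $G^*$ be a DAG on $V$ and let $G\in[G^*]$. Then $$\nu_1(G)\;\ge\;\max_{\mathcal I\subseteq V}\ \sum_{H\in CC(\mathcal E_{\mathcal I}(G))}\left\lfloor\frac{\omega(H)}{2}\right\rfloor .$$ In particular, this holds for $G=G^*$. -/

import Mathlib

/-- A directed acyclic graph on the vertex set `V`. -/
structure DAG (V : Type*) extends Digraph V where
  acyclic : ∀ v, ¬ Relation.TransGen Adj v v

/-- A partially directed graph: between two distinct vertices there is an undirected edge, or an
arc in one direction, or nothing. -/
@[ext] structure PDGraph (V : Type*) where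
  edges : SimpleGraph V
  arcs : Digraph V
  arcs_irrefl : ∀ u, ¬ arcs.Adj u u
  arcs_asymm : ∀ u v, arcs.Adj u v → ¬ arcs.Adj v u
  arcs_not_edge : ∀ u v, arcs.Adj u v → ¬ edges.Adj u v

namespace DAG

variable {V : Type*}

theorem irrefl (G : DAG V) (u : V) : ¬ G.Adj u u :=
  fun h => G.acyclic u (Relation.TransGen.single h)

theorem asymm (G : DAG V) (u v : V) (h : G.Adj u v) : ¬ G.Adj v u :=
  fun h' => G.acyclic u ((Relation.TransGen.single h).tail h')

/-- A DAG, seen as a partially directed graph without undirected edges. -/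
def toPDGraph (G : DAG V) : PDGraph V where
  edges := ⊥
  arcs := G.toDigraph
  arcs_irrefl := G.irrefl
  arcs_asymm := G.asymm
  arcs_not_edge := fun _ _ _ h => h

/-- The skeleton: all orientations are forgotten. -/
def skeleton (G : DAG V) : SimpleGraph V := G.toDigraph.toSimpleGraphInclusive

/-- `u → v ← w` with `u ≠ w` and `u`, `w` not adjacent. -/
def IsVStructure (G : DAG V) (u v w : V) : Prop :=
  G.Adj u v ∧ G.Adj w v ∧ u ≠ w ∧ ¬ G.skeleton.Adj u w

/-- Markov equivalence: the same skeleton and the same v-structures. -/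
def MarkovEquiv (G D : DAG V) : Prop :=
  G.skeleton = D.skeleton ∧ ∀ u v w, G.IsVStructure u v w ↔ D.IsVStructure u v w

/-- The Markov equivalence class `[G]`. -/
def markovClass (G : DAG V) : Set (DAG V) := {D | MarkovEquiv G D}

/-- The interventional graph `G_S`: all arcs into vertices of `S` are removed. -/
def doGraph (G : DAG V) (S : Finset V) : DAG V where
  Adj u v := G.Adj u v ∧ v ∉ S
  acyclic v h := G.acyclic v (Relation.TransGen.mono (fun _ _ h => h.1) _ _ h)

/-- The interventional Markov equivalence class of `G` for an intervention set `I`: the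
DAGs in `[G]` whose interventional graph for each `S ∈ I` is Markov equivalent to `G_S`. The
observational data (the intervention `∅`) are always included. -/
def interventionalClass (I : Finset (Finset V)) (G : DAG V) : Set (DAG V) :=
  {D | D ∈ G.markovClass ∧ ∀ S ∈ I, MarkovEquiv (G.doGraph S) (D.doGraph S)}

theorem self_mem_interventionalClass (I : Finset (Finset V)) (G : DAG V) :
    G ∈ G.interventionalClass I :=
  ⟨⟨rfl, fun _ _ _ => Iff.rfl⟩, fun _ _ => ⟨rfl, fun _ _ _ => Iff.rfl⟩⟩

/-- The `I`-essential graph of `G`: an arc `u → v` where all members of the interventional Markov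
equivalence class agree on `u → v`, an undirected edge where they disagree. -/
def essentialGraph (I : Finset (Finset V)) (G : DAG V) : PDGraph V where
  edges :=
    { Adj := fun u v =>
        (∃ D ∈ G.interventionalClass I, D.Adj u v) ∧ (∃ D ∈ G.interventionalClass I, D.Adj v u)
      symm := ⟨fun _ _ h => ⟨h.2, h.1⟩⟩
      loopless := ⟨fun u h => h.1.elim fun D hD => D.irrefl u hD.2⟩ }
  arcs := { Adj := fun u v => ∀ D ∈ G.interventionalClass I, D.Adj u v }
  arcs_irrefl := fun u h => G.irrefl u (h G (G.self_mem_interventionalClass I))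
  arcs_asymm := fun u v h h' =>
    G.asymm u v (h G (G.self_mem_interventionalClass I)) (h' G (G.self_mem_interventionalClass I))
  arcs_not_edge := fun u v h h' => h'.2.elim fun D hD => D.asymm u v (h D hD.1) hD.2

/-- `I` is a verifying set for `G`: the `I`-essential graph of `G` is fully oriented, i.e. it
is `G`. -/
def IsVerifyingSet (I : Finset (Finset V)) (G : DAG V) : Prop :=
  G.essentialGraph I = G.toPDGraph

/-- The minimum verification number `ν_k(G)`: the least size of a verifying set for `G` all of
whose interventions have at most `k` vertices. -/
noncomputable def verificationNumber (k : ℕ) (G : DAG V) : ℕ :=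
  sInf {m | ∃ I : Finset (Finset V), (∀ S ∈ I, S.card ≤ k) ∧ G.IsVerifyingSet I ∧ I.card = m}

end DAG

/-- The atomic intervention set given by a set of vertices: `{ {v} : v ∈ I }`. -/
def atomicInterventions {V : Type*} (I : Finset V) : Finset (Finset V) :=
  I.map ⟨singleton, Finset.singleton_injective⟩

/-- The chain components of a partially directed graph: the connected components of the
undirected graph that remains after all arcs are removed. -/
abbrev PDGraph.ChainComponent {V : Type*} (P : PDGraph V) : Type _ := P.edges.ConnectedComponent

noncomputable instance PDGraph.instFintypeChainComponent {V : Type*} [Finite V] (P : PDGraph V) :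
    Fintype P.ChainComponent := Fintype.ofFinite _

/-!
Write `d v` for the number of parents of `v` along undecided edges, the edges whose direction is
not forced in the `I`-essential graph of `G`. The lower bound rests on covered arcs `u → v`, those
where the parents of `v` are `u` and the parents of `u`. Reversing a covered arc outside all
interventions keeps a DAG in its interventional class, so a verifying set meets every covered arc
(`DAG.IsVerifyingSet.exists_mem_of_isCovered`).

In a chain component `H`, the last vertex of a largest clique has `d v ≥ ω(H) - 1`. The
undecided parents of a vertex `v` are pairwise adjacent along undecided edges, so if `u` is the
last of them, the others are undecided parents of `u`. Hence `d v ≤ d u + 1`, and `u → v` is covered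
in `G` in the case of equality, because the ends of an undecided edge have the same forced incoming
arcs. So for each `j < ω(H) - 1` the component contains a covered arc on which `d` goes from `j` to
`j + 1` (`DAG.exists_isCovered_card`). For even `j` these `⌊ω(H) / 2⌋` arcs are disjoint, as `d`
takes distinct values on them; arcs of distinct components are disjoint anyway. A verifying set of
interventions of size at most one needs a separate intervention for each of them.

What remains is the structure of the essential graph: forced arcs into one end of an undecided edge
also go into the other end. This is proved by induction for the arcs derived by Meek's orientation
rules (`DAG.MeekArc.of_undecided`), and these are exactly the forced arcs: the edges the rules do
not decide can be oriented along any perfect ordering of the graph they form, and some perfect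
ordering starts at any given vertex (`SimpleGraph.exists_perfect_rank`), so that every undecided
edge takes both directions (`DAG.exists_adj_of_undecided`).
-/

namespace DAG

variable {V : Type*}

theorem skeleton_adj (G : DAG V) {u v : V} : G.skeleton.Adj u v ↔ G.Adj u v ∨ G.Adj v u := by
  constructor
  · intro h
    simpa [skeleton, Digraph.toSimpleGraphInclusive] using h.2
  · intro h
    refine ⟨?_, by simpa using h⟩
    rintro rfl
    exact h.elim (G.irrefl u) (G.irrefl u)

theorem adj_trans_of_skeleton (G : DAG V) {u v w : V} (huv : G.Adj u v) (hvw : G.Adj v w)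
    (huw : G.skeleton.Adj u w) : G.Adj u w := by
  rcases G.skeleton_adj.1 huw with h | h
  · exact h
  · exact absurd (((Relation.TransGen.single huv).tail hvw).tail h) (G.acyclic u)

/-- A nonempty finite set of vertices has a member without children in the set. -/
theorem exists_sink [Finite V] (G : DAG V) {t : Finset V} (ht : t.Nonempty) :
    ∃ z ∈ t, ∀ x ∈ t, ¬ G.Adj z x := by
  have : IsTrans V fun a b => Relation.TransGen G.Adj b a := ⟨fun _ _ _ h h' => h'.trans h⟩
  have : Std.Irrefl fun a b => Relation.TransGen G.Adj b a := ⟨G.acyclic⟩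
  obtain ⟨z, hz, hmin⟩ := (Finite.wellFounded_of_trans_of_irrefl
    fun a b => Relation.TransGen G.Adj b a).has_min (t : Set V) ht
  exact ⟨z, hz, fun x hx h => hmin x hx (.single h)⟩

/-- A nonempty finite set of vertices has a member without parents in the set. -/
theorem exists_source [Finite V] (G : DAG V) {t : Finset V} (ht : t.Nonempty) :
    ∃ z ∈ t, ∀ x ∈ t, ¬ G.Adj x z := by
  have : IsTrans V (Relation.TransGen G.Adj) := ⟨fun _ _ _ h h' => h.trans h'⟩
  have : Std.Irrefl (Relation.TransGen G.Adj) := ⟨G.acyclic⟩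
  obtain ⟨z, hz, hmin⟩ := (Finite.wellFounded_of_trans_of_irrefl
    (Relation.TransGen G.Adj)).has_min (t : Set V) ht
  exact ⟨z, hz, fun x hx h => hmin x hx (.single h)⟩

/-! ### Covered arcs -/

/-- An arc `u → v` is covered if the parents of `v` are `u` and the parents of `u`. -/
def IsCovered (G : DAG V) (u v : V) : Prop :=
  G.Adj u v ∧ ∀ a, G.Adj a v ↔ G.Adj a u ∨ a = u

/-- The DAG with the covered arc `u → v` reversed. -/
def reverse (G : DAG V) {u v : V} (h : G.IsCovered u v) : DAG V where
  Adj a b := (G.Adj a b ∧ ¬ (a = u ∧ b = v)) ∨ (a = v ∧ b = u)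
  acyclic := by
    let R : V → V → Prop := fun a b => G.Adj a b ∧ ¬ (a = u ∧ b = v)
    have key : ∀ x y, Relation.TransGen (fun a b => R a b ∨ (a = v ∧ b = u)) x y →
        Relation.TransGen R x y ∨
          (Relation.ReflTransGen R x v ∧ Relation.ReflTransGen R u y) := by
      intro x y hxy
      induction hxy with
      | single h =>
        rcases h with h | ⟨rfl, rfl⟩
        · exact .inl (.single h)
        · exact .inr ⟨.refl, .refl⟩
      | tail _ h ih =>
        rcases h with h | ⟨rfl, rfl⟩
        · rcases ih with ih | ⟨h1, h2⟩
          · exact .inl (ih.tail h)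
          · exact .inr ⟨h1, h2.tail h⟩
        · rcases ih with ih | ⟨h1, -⟩
          · exact .inr ⟨ih.to_reflTransGen, .refl⟩
          · exact .inr ⟨h1, .refl⟩
    intro x hx
    rcases key x x hx with hc | ⟨h1, h2⟩
    · exact G.acyclic x (Relation.TransGen.mono (fun _ _ h => h.1) _ _ hc)
    · -- The last arc of a path from `u` to `v` other than `u → v` starts at a parent of `u`.
      rcases Relation.ReflTransGen.cases_tail (h2.trans h1) with rfl | ⟨p, hp, hpv⟩
      · exact G.irrefl _ h.1
      · have hpu : G.Adj p u := ((h.2 p).1 hpv.1).resolve_right fun e => hpv.2 ⟨e, rfl⟩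
        exact G.acyclic u
          (Relation.TransGen.tail' (Relation.ReflTransGen.mono (fun _ _ h => h.1) _ _ hp) hpu)

theorem markovEquiv_of_reverse {G D : DAG V} {u v : V} (h : G.IsCovered u v)
    (hD : ∀ a b, D.Adj a b ↔ (G.Adj a b ∧ ¬ (a = u ∧ b = v)) ∨ (a = v ∧ b = u)) :
    MarkovEquiv G D := by
  have hskel : G.skeleton = D.skeleton := by
    ext a b
    have huv := h.1
    rw [skeleton_adj, skeleton_adj, hD, hD]
    constructor
    · grind
    · rintro ((h | ⟨rfl, rfl⟩) | (h | ⟨rfl, rfl⟩))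
      exacts [.inl h.1, .inr huv, .inr h.1, .inl huv]
  refine ⟨hskel, fun a b c => ?_⟩
  unfold IsVStructure
  rw [← hskel, hD, hD, skeleton_adj]
  have hcov := h.2
  constructor
  · rintro ⟨hab, hcb, hne, hna⟩
    refine ⟨.inl ⟨hab, ?_⟩, .inl ⟨hcb, ?_⟩, hne, hna⟩
    · rintro ⟨rfl, rfl⟩
      exact hna (.inr (((hcov c).1 hcb).resolve_right hne.symm))
    · rintro ⟨rfl, rfl⟩
      exact hna (.inl (((hcov a).1 hab).resolve_right hne))
  · rintro ⟨hab | ⟨rfl, rfl⟩, hcb | ⟨rfl, h'⟩, hne, hna⟩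
    · exact ⟨hab.1, hcb.1, hne, hna⟩
    · subst h'
      exact absurd (.inl ((hcov a).2 (.inl hab.1))) hna
    · exact absurd (.inr ((hcov c).2 (.inl hcb.1))) hna
    · exact absurd rfl hne

/-- A verifying set contains an intervention meeting each covered arc: otherwise the reversal of
the arc would stay in the interventional class. -/
theorem IsVerifyingSet.exists_mem_of_isCovered {G : DAG V} {J : Finset (Finset V)}
    (hJ : G.IsVerifyingSet J) {u v : V} (h : G.IsCovered u v) :
    ∃ S ∈ J, u ∈ S ∨ v ∈ S := by
  by_contra! hcon
  have hmem : G.reverse h ∈ G.interventionalClass J := by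
    refine ⟨markovEquiv_of_reverse h fun _ _ => Iff.rfl, fun S hS => ?_⟩
    obtain ⟨hu, hv⟩ := hcon S hS
    have hcov : (G.doGraph S).IsCovered u v := by
      refine ⟨⟨h.1, hv⟩, fun a => ?_⟩
      simp only [doGraph, hu, hv, not_false_eq_true, and_true]
      exact h.2 a
    refine markovEquiv_of_reverse hcov fun a b => ?_
    simp only [doGraph, reverse]
    grind
  have harc : (G.essentialGraph J).arcs.Adj u v := by
    rw [hJ]
    exact h.1
  exact (G.reverse h).asymm u v (harc _ hmem) (.inr ⟨rfl, rfl⟩)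

/-- The set of all singletons is verifying. -/
theorem isVerifyingSet_singletons [Fintype V] (G : DAG V) :
    G.IsVerifyingSet (atomicInterventions Finset.univ) := by
  have key : ∀ D ∈ G.interventionalClass (atomicInterventions Finset.univ), ∀ u v,
      G.Adj u v → D.Adj u v := by
    intro D hD u v huv
    have hs : (G.doGraph {u}).skeleton.Adj u v :=
      skeleton_adj _ |>.2 (.inl ⟨huv, fun h => G.irrefl u (by simp_all)⟩)
    rw [(hD.2 {u} (by simp [atomicInterventions])).1, skeleton_adj] at hs
    exact (hs.resolve_right fun h => h.2 (by simp)).1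
  have hmem := G.self_mem_interventionalClass (atomicInterventions Finset.univ)
  refine PDGraph.ext ?_ ?_
  · ext u v
    refine ⟨?_, False.elim⟩
    rintro ⟨⟨D, hD, h⟩, D', hD', h'⟩
    have hs : G.skeleton.Adj u v := by
      rw [hD.1.1]
      exact D.skeleton_adj.2 (.inl h)
    rcases G.skeleton_adj.1 hs with hG | hG
    · exact D'.asymm _ _ h' (key D' hD' _ _ hG)
    · exact D.asymm _ _ h (key D hD _ _ hG)
  · ext u v
    exact ⟨fun h => h G hmem, fun h D hD => key D hD u v h⟩

/-! ### Perfect orderings -/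

/-- In a finite graph all of whose induced subgraphs have a simplicial vertex, the vertices can be
ranked such that the earlier neighbours of each vertex form a clique and any prescribed clique `K`
comes first. -/
theorem _root_.SimpleGraph.exists_perfect_rank (U : SimpleGraph V)
    (hU : ∀ t : Finset V, t.Nonempty → ∃ z ∈ t, ∀ u ∈ t, ∀ w ∈ t, U.Adj u z → U.Adj w z →
      u ≠ w → U.Adj u w) (s : Finset V) :
    ∀ K ⊆ s, (∀ u ∈ K, ∀ w ∈ K, u ≠ w → U.Adj u w) →
    ∃ r : V → ℕ, (∀ x ∈ s, ∀ y ∈ s, r x = r y → x = y) ∧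
      (∀ u ∈ s, ∀ w ∈ s, ∀ v ∈ s, U.Adj u v → U.Adj w v → r u < r v → r w < r v → u ≠ w →
        U.Adj u w) ∧
      ∀ x ∈ K, ∀ y ∈ s, y ∉ K → r x < r y := by
  classical
  induction hn : s.card generalizing s with
  | zero =>
    intro K hK _
    obtain rfl := Finset.card_eq_zero.1 hn
    exact ⟨fun _ => 0, by simp, by simp, by simp⟩
  | succ n ih =>
    intro K hK hKc
    obtain ⟨z, hz, hsimp⟩ := hU s (Finset.card_pos.1 (by omega))
    have hcard : (s.erase z).card = n := by rw [Finset.card_erase_of_mem hz]; omega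
    have hB : ∀ x ∈ s, ∀ r : V → ℕ, r x ≤ s.sup r := fun x hx r => Finset.le_sup hx
    by_cases hzK : z ∈ K
    · -- Start with the neighbours of `z`, then move `K` to the front, with `z` first.
      obtain ⟨r, hinj, hperf, hfirst⟩ := ih (s.erase z) hcard
        ((s.erase z).filter fun x => U.Adj x z) (Finset.filter_subset _ _) (by
          intro u hu w hw hne
          simp only [Finset.mem_filter, Finset.mem_erase] at hu hw
          exact hsimp u hu.1.2 w hw.1.2 hu.2 hw.2 hne)
      have hKadj : ∀ x ∈ K, x ≠ z → U.Adj x z := fun x hx hne => hKc x hx z hzK hne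
      have hfirst' : ∀ x ∈ s, ∀ y ∈ s, x ≠ z → y ≠ z → U.Adj x z → ¬ U.Adj y z →
          r x < r y := by
        intro x hx y hy hxz hyz hx' hy'
        exact hfirst x (by simp [hx, hxz, hx']) y (by simp [hy, hyz]) (by simp [hy'])
      have hle : ∀ x ∈ s, r x ≤ s.sup r := fun x hx => hB x hx r
      generalize s.sup r = B at hle
      let r' : V → ℕ := fun x => if x = z then 0 else r x + 1 + if x ∈ K then 0 else B + 1
      have hr0 : r' z = 0 := by simp [r']
      have hr1 : ∀ x, x ≠ z → x ∈ K → r' x = r x + 1 := fun x h1 h2 => by simp [r', h1, h2]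
      have hr2 : ∀ x, x ≠ z → x ∉ K → r' x = r x + 1 + (B + 1) :=
        fun x h1 h2 => by simp [r', h1, h2]
      clear_value r'
      -- A vertex not adjacent to `z` keeps its predecessors.
      have hold : ∀ x ∈ s, ∀ y ∈ s, x ≠ z → y ≠ z → ¬ U.Adj y z → r' x < r' y → r x < r y := by
        intro x hx y hy hxz hyz hyadj hlt
        have hyK : y ∉ K := fun h => hyadj (hKadj y h hyz)
        by_cases hxK : x ∈ K
        · exact hfirst' x hx y hy hxz hyz (hKadj x hxK hxz) hyadj
        · rw [hr2 x hxz hxK, hr2 y hyz hyK] at hlt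
          omega
      -- The predecessors of a neighbour of `z` are `z` and neighbours of `z`.
      have hnew : ∀ x ∈ s, ∀ y ∈ s, x ≠ z → y ≠ z → U.Adj y z → r' x < r' y → U.Adj x z := by
        intro x hx y hy hxz hyz hyadj hlt
        by_contra hxadj
        have hxK : x ∉ K := fun h => hxadj (hKadj x h hxz)
        have := hfirst' y hy x hx hyz hxz hyadj hxadj
        rw [hr2 x hxz hxK] at hlt
        by_cases hyK : y ∈ K
        · rw [hr1 y hyz hyK] at hlt
          omega
        · rw [hr2 y hyz hyK] at hlt
          omega
      refine ⟨r', ?_, ?_, ?_⟩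
      · intro x hx y hy hxy
        by_cases hxz : x = z <;> by_cases hyz : y = z
        · rw [hxz, hyz]
        · exfalso
          subst hxz
          by_cases hyK : y ∈ K
          · rw [hr0, hr1 y hyz hyK] at hxy
            omega
          · rw [hr0, hr2 y hyz hyK] at hxy
            omega
        · exfalso
          subst hyz
          by_cases hxK : x ∈ K
          · rw [hr0, hr1 x hxz hxK] at hxy
            omega
          · rw [hr0, hr2 x hxz hxK] at hxy
            omega
        · have hx' := hle x hx
          have hy' := hle y hy
          refine hinj x (by simp [hx, hxz]) y (by simp [hy, hyz]) ?_
          by_cases hxK : x ∈ K <;> by_cases hyK : y ∈ K <;>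
            simp only [hxK, hyK, hxz, hyz, hr1, hr2, ne_eq, not_false_eq_true] at hxy <;> omega
      · intro u hu w hw v hv huv hwv hru hrw hne
        have hvz : v ≠ z := by
          rintro rfl
          omega
        by_cases hvadj : U.Adj v z
        · by_cases huz : u = z
          · subst huz
            exact (hnew w hw v hv hne.symm hvz hvadj hrw).symm
          · by_cases hwz : w = z
            · subst hwz
              exact hnew u hu v hv hne hvz hvadj hru
            · exact hsimp u hu w hw (hnew u hu v hv huz hvz hvadj hru)
                (hnew w hw v hv hwz hvz hvadj hrw) hne
        · have huz : u ≠ z := fun e => hvadj (e ▸ huv.symm)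
          have hwz : w ≠ z := fun e => hvadj (e ▸ hwv.symm)
          exact hperf u (by simp [hu, huz]) w (by simp [hw, hwz]) v (by simp [hv, hvz]) huv hwv
            (hold u hu v hv huz hvz hvadj hru) (hold w hw v hv hwz hvz hvadj hrw) hne
      · intro x hx y hy hyK
        have hyz : y ≠ z := fun e => hyK (e ▸ hzK)
        have := hle x (hK hx)
        rw [hr2 y hyz hyK]
        by_cases hxz : x = z
        · rw [hxz, hr0]
          omega
        · rw [hr1 x hxz hx]
          omega
    · -- Rank the other vertices, and put `z` last.
      have hKt : K ⊆ s.erase z := fun x hx =>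
        Finset.mem_erase.2 ⟨fun e => hzK (e ▸ hx), hK hx⟩
      obtain ⟨r, hinj, hperf, hfirst⟩ := ih (s.erase z) hcard K hKt hKc
      have hle : ∀ x ∈ s, r x ≤ s.sup r := fun x hx => hB x hx r
      generalize s.sup r = B at hle
      let r' : V → ℕ := Function.update r z (B + 1)
      have hr0 : r' z = B + 1 := by simp [r']
      have hr1 : ∀ x, x ≠ z → r' x = r x := fun x h => by simp [r', h]
      clear_value r'
      refine ⟨r', ?_, ?_, ?_⟩
      · intro x hx y hy hxy
        have hx' := hle x hx
        have hy' := hle y hy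
        by_cases hxz : x = z <;> by_cases hyz : y = z
        · rw [hxz, hyz]
        · rw [hxz, hr0, hr1 y hyz] at hxy
          omega
        · rw [hyz, hr0, hr1 x hxz] at hxy
          omega
        · rw [hr1 x hxz, hr1 y hyz] at hxy
          exact hinj x (by simp [hx, hxz]) y (by simp [hy, hyz]) hxy
      · intro u hu w hw v hv huv hwv hru hrw hne
        by_cases hvz : v = z
        · subst hvz
          exact hsimp u hu w hw huv hwv hne
        · have hv' := hle v hv
          rw [hr1 v hvz] at hru hrw
          have huz : u ≠ z := by
            rintro rfl
            omega
          have hwz : w ≠ z := by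
            rintro rfl
            omega
          rw [hr1 _ huz] at hru
          rw [hr1 _ hwz] at hrw
          exact hperf u (by simp [hu, huz]) w (by simp [hw, hwz]) v (by simp [hv, hvz]) huv hwv
            hru hrw hne
      · intro x hx y hy hyK
        have hxz : x ≠ z := fun e => hzK (e ▸ hx)
        rw [hr1 x hxz]
        by_cases hyz : y = z
        · have := hle x (hK hx)
          rw [hyz, hr0]
          omega
        · rw [hr1 y hyz]
          exact hfirst x hx y (by simp [hy, hyz]) hyK

/-! ### Orientation rules -/

/-- The arcs of `G` obtained from those of its v-structures and those at vertices of `I` by the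
first three of Meek's orientation rules. Where such a rule asks for an undirected edge, a weaker
condition on the skeleton and the v-structures of `G` is used, which keeps the rule sound. -/
inductive MeekArc (G : DAG V) (I : Finset V) : V → V → Prop
  | vStructure {a b c : V} : G.IsVStructure a b c → MeekArc G I a b
  | target {a b : V} : G.Adj a b → a ∈ I ∨ b ∈ I → MeekArc G I a b
  | away {a b d : V} : MeekArc G I d a → G.Adj a b → ¬ G.skeleton.Adj d b → MeekArc G I a b
  | trans {a b d : V} : MeekArc G I a d → MeekArc G I d b → G.skeleton.Adj a b → MeekArc G I a b
  | kite {a b d e : V} : MeekArc G I d b → MeekArc G I e b → G.skeleton.Adj a b →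
      G.skeleton.Adj a d → G.skeleton.Adj a e → d ≠ e → ¬ G.skeleton.Adj d e →
      ¬ G.IsVStructure d a e → MeekArc G I a b

theorem adj_iff_of_mem_target {G D : DAG V} {I : Finset V}
    (hD : D ∈ G.interventionalClass (atomicInterventions I)) {u v : V} (hI : u ∈ I ∨ v ∈ I)
    (huv : G.Adj u v) : D.Adj u v := by
  rcases hI with hu | hv
  · have hs : (G.doGraph {u}).skeleton.Adj u v :=
      skeleton_adj _ |>.2 (.inl ⟨huv, fun h => G.irrefl u (by simp_all)⟩)
    rw [(hD.2 {u} (by simpa [atomicInterventions] using hu)).1, skeleton_adj] at hs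
    exact (hs.resolve_right fun h => h.2 (by simp)).1
  · have hs : G.skeleton.Adj u v := G.skeleton_adj.2 (.inl huv)
    rw [hD.1.1, skeleton_adj] at hs
    refine hs.resolve_right fun hvu => ?_
    have hs' : (D.doGraph {v}).skeleton.Adj v u :=
      skeleton_adj _ |>.2 (.inl ⟨hvu, fun h => D.irrefl v (by simp_all)⟩)
    rw [← (hD.2 {v} (by simpa [atomicInterventions] using hv)).1, skeleton_adj] at hs'
    exact G.asymm _ _ huv (hs'.resolve_right fun h => h.2 (by simp)).1

theorem MeekArc.adj {G : DAG V} {I : Finset V} {a b : V} (h : G.MeekArc I a b) : G.Adj a b := by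
  induction h with
  | vStructure h => exact h.1
  | target h => exact h
  | away _ h => exact h
  | trans _ _ h ih ih' => exact G.adj_trans_of_skeleton ih ih' h
  | kite _ _ hab had hae hne hn hv ihd ihe =>
    exact (G.skeleton_adj.1 hab).resolve_right fun hba => hv
      ⟨G.adj_trans_of_skeleton ihd hba had.symm, G.adj_trans_of_skeleton ihe hba hae.symm, hne, hn⟩

/-- Soundness: the members of the interventional class agree on the derived arcs. -/
theorem MeekArc.sound {G D : DAG V} {I : Finset V}
    (hD : D ∈ G.interventionalClass (atomicInterventions I)) {a b : V} (h : G.MeekArc I a b) :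
    D.Adj a b := by
  have hs : ∀ {x y}, G.skeleton.Adj x y ↔ D.skeleton.Adj x y := fun {x y} => by rw [hD.1.1]
  induction h with
  | vStructure h => exact ((hD.1.2 _ _ _).1 h).1
  | target h hI => exact adj_iff_of_mem_target hD hI h
  | @away a b d hda hab hn ih =>
    refine (D.skeleton_adj.1 (hs.1 (G.skeleton_adj.2 (.inl hab)))).resolve_right fun hba => ?_
    have hne : d ≠ b := fun e => G.asymm _ _ hab (e ▸ hda.adj)
    exact G.asymm _ _ hab ((hD.1.2 d a b).2 ⟨ih, hba, hne, fun h => hn (hs.2 h)⟩).2.1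
  | trans _ _ h ih ih' => exact D.adj_trans_of_skeleton ih ih' (hs.1 h)
  | @kite a b d e _ _ hab had hae hne hn hv ihd ihe =>
    refine (D.skeleton_adj.1 (hs.1 hab)).resolve_right fun hba => hv ((hD.1.2 d a e).2 ?_)
    exact ⟨D.adj_trans_of_skeleton ihd hba (hs.1 had.symm),
      D.adj_trans_of_skeleton ihe hba (hs.1 hae.symm), hne, fun h => hn (hs.2 h)⟩

/-- The graph of the edges that the orientation rules leave undecided. -/
def undecided (G : DAG V) (I : Finset V) : SimpleGraph V where
  Adj u v := G.skeleton.Adj u v ∧ ¬ G.MeekArc I u v ∧ ¬ G.MeekArc I v u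
  symm := ⟨fun _ _ h => ⟨h.1.symm, h.2.2, h.2.1⟩⟩
  loopless := ⟨fun _ h => h.1.ne rfl⟩

theorem MeekArc.skeleton_adj_of_undecided {G : DAG V} {I : Finset V} {a b c : V}
    (h : G.MeekArc I a b) (hbc : (G.undecided I).Adj b c) : G.skeleton.Adj a c := by
  by_contra hn
  rcases G.skeleton_adj.1 hbc.1 with hG | hG
  · exact hbc.2.1 (h.away hG hn)
  · have hne : c ≠ a := fun e => hbc.2.2 (e ▸ h)
    exact hbc.2.2 (.vStructure ⟨hG, h.adj, hne, fun h => hn h.symm⟩)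

/-- The vertices of an undecided edge have the same incoming derived arcs. -/
theorem MeekArc.of_undecided {G : DAG V} {I : Finset V} {a b : V} (h : G.MeekArc I a b) :
    ∀ {c : V}, (G.undecided I).Adj b c → G.MeekArc I a c := by
  have hdich : ∀ {a b c : V}, G.MeekArc I a b → (G.undecided I).Adj b c →
      G.MeekArc I a c ∨ (G.undecided I).Adj a c := by
    intro a b c h hbc
    have hac := h.skeleton_adj_of_undecided hbc
    by_cases h1 : G.MeekArc I a c
    · exact .inl h1
    · exact .inr ⟨hac, h1, fun h2 => hbc.2.2 (h2.trans h hbc.1.symm)⟩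
  induction h with
  | @vStructure a b d h =>
    intro c hbc
    have hab : G.MeekArc I a b := .vStructure h
    have hdb : G.MeekArc I d b :=
      .vStructure ⟨h.2.1, h.1, h.2.2.1.symm, fun h' => h.2.2.2 h'.symm⟩
    by_cases hv : G.IsVStructure a c d
    · exact .vStructure hv
    · exact absurd (MeekArc.kite hab hdb hbc.1.symm (hab.skeleton_adj_of_undecided hbc).symm
        (hdb.skeleton_adj_of_undecided hbc).symm h.2.2.1 h.2.2.2 hv) hbc.2.2
  | @target a b hadj hI =>
    intro c hbc
    have hab : G.MeekArc I a b := .target hadj hI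
    rcases hI with ha | hb
    · refine (hdich hab hbc).resolve_right fun hac => ?_
      rcases G.skeleton_adj.1 hac.1 with hG | hG
      · exact hac.2.1 (.target hG (.inl ha))
      · exact hac.2.2 (.target hG (.inr ha))
    · rcases G.skeleton_adj.1 hbc.1 with hG | hG
      · exact absurd (.target hG (.inl hb)) hbc.2.1
      · exact absurd (.target hG (.inr hb)) hbc.2.2
  | @away a b d hda hadj hn ih =>
    intro c hbc
    refine (hdich (hda.away hadj hn) hbc).resolve_right fun hac => ?_
    have hdc := ih hac
    rcases G.skeleton_adj.1 hbc.1 with hG | hG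
    · have hne : d ≠ b := fun e => G.asymm _ _ hadj (e ▸ hda.adj)
      exact hbc.2.1 (.vStructure ⟨hG, hdc.adj, hne.symm, fun h => hn h.symm⟩)
    · exact hbc.2.2 (hdc.away hG hn)
  | trans had hdb hab _ ih =>
    intro c hbc
    exact had.trans (ih hbc) ((had.trans hdb hab).skeleton_adj_of_undecided hbc)
  | kite hdb heb hab had hae hne hn hv ihd ihe =>
    intro c hbc
    have h := MeekArc.kite hdb heb hab had hae hne hn hv
    exact .kite (ihd hbc) (ihe hbc) (h.skeleton_adj_of_undecided hbc) had hae hne hn hv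

/-- In `G`, two parents of a vertex along undecided edges are joined by an undecided edge. -/
theorem undecided_adj_of_parents {G : DAG V} {I : Finset V} {u w v : V}
    (hu : (G.undecided I).Adj u v) (hw : (G.undecided I).Adj w v) (huv : G.Adj u v)
    (hwv : G.Adj w v) (hne : u ≠ w) : (G.undecided I).Adj u w := by
  refine ⟨?_, fun h => hu.2.1 (h.of_undecided hw), fun h => hw.2.1 (h.of_undecided hu)⟩
  by_contra hn
  exact hu.2.1 (.vStructure ⟨huv, hwv, hne, hn⟩)

/-- The derived arcs together with the undecided edges, oriented by increasing rank. -/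
def orient (G : DAG V) (I : Finset V) (r : V → ℕ) : DAG V where
  Adj a b := G.MeekArc I a b ∨ ((G.undecided I).Adj a b ∧ r a < r b)
  acyclic := by
    let R : V → V → Prop := fun a b => (G.undecided I).Adj a b ∧ r a < r b
    have hR : ∀ {x y}, Relation.TransGen R x y → r x < r y := by
      intro x y h
      induction h with
      | single h => exact h.2
      | tail _ h ih => exact ih.trans h.2
    have hext : ∀ {x y z}, Relation.TransGen (G.MeekArc I) x y → Relation.ReflTransGen R y z →
        Relation.TransGen (G.MeekArc I) x z := by
      intro x y z hxy hyz
      induction hyz with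
      | refl => exact hxy
      | tail _ h ih =>
        obtain ⟨p, hp, hpy⟩ := Relation.TransGen.tail'_iff.1 ih
        exact .tail' hp (hpy.of_undecided h.1)
    -- Undecided steps after a derived arc can be absorbed into it.
    have key : ∀ x y, Relation.TransGen (fun a b => G.MeekArc I a b ∨ R a b) x y →
        Relation.TransGen R x y ∨
          ∃ p, Relation.ReflTransGen R x p ∧ Relation.TransGen (G.MeekArc I) p y := by
      intro x y hxy
      induction hxy with
      | single h =>
        rcases h with h | h
        · exact .inr ⟨x, .refl, .single h⟩
        · exact .inl (.single h)
      | tail _ h ih =>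
        rcases h with h | h
        · rcases ih with ih | ⟨p, h1, h2⟩
          · exact .inr ⟨_, ih.to_reflTransGen, .single h⟩
          · exact .inr ⟨p, h1, h2.tail h⟩
        · rcases ih with ih | ⟨p, h1, h2⟩
          · exact .inl (ih.tail h)
          · exact .inr ⟨p, h1, hext h2 (.single h)⟩
    intro x hx
    rcases key x x hx with h | ⟨p, h1, h2⟩
    · exact lt_irrefl _ (hR h)
    · exact G.acyclic p (Relation.TransGen.mono (fun _ _ h => h.adj) _ _ (hext h2 h1))

theorem orient_mem_interventionalClass (G : DAG V) (I : Finset V) {r : V → ℕ}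
    (hr : Function.Injective r)
    (hperf : ∀ u w v, (G.undecided I).Adj u v → (G.undecided I).Adj w v → r u < r v →
      r w < r v → u ≠ w → (G.undecided I).Adj u w) :
    G.orient I r ∈ G.interventionalClass (atomicInterventions I) := by
  have hskel : G.skeleton = (G.orient I r).skeleton := by
    ext a b
    rw [skeleton_adj (G.orient I r)]
    constructor
    · intro h
      by_cases h1 : G.MeekArc I a b
      · exact .inl (.inl h1)
      by_cases h2 : G.MeekArc I b a
      · exact .inr (.inl h2)
      rcases lt_trichotomy (r a) (r b) with hlt | heq | hlt
      · exact .inl (.inr ⟨⟨h, h1, h2⟩, hlt⟩)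
      · exact absurd (hr heq) h.ne
      · exact .inr (.inr ⟨⟨h.symm, h2, h1⟩, hlt⟩)
    · rintro ((h | h) | (h | h))
      · exact G.skeleton_adj.2 (.inl h.adj)
      · exact h.1.1
      · exact G.skeleton_adj.2 (.inr h.adj)
      · exact h.1.1.symm
  have hv : ∀ u v w, G.IsVStructure u v w ↔ (G.orient I r).IsVStructure u v w := by
    intro u v w
    constructor
    · intro h
      exact ⟨.inl (.vStructure h),
        .inl (.vStructure ⟨h.2.1, h.1, h.2.2.1.symm, fun h' => h.2.2.2 h'.symm⟩), h.2.2.1,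
        hskel ▸ h.2.2.2⟩
    · rintro ⟨hu | hu, hw | hw, hne, hn⟩
      all_goals rw [← hskel] at hn
      · exact ⟨hu.adj, hw.adj, hne, hn⟩
      · exact absurd (hu.skeleton_adj_of_undecided hw.1.symm) hn
      · exact absurd (hw.skeleton_adj_of_undecided hu.1.symm).symm hn
      · exact absurd (hperf u w v hu.1 hw.1 hu.2 hw.2 hne).1 hn
  have hagree : ∀ a b, a ∈ I ∨ b ∈ I → (G.Adj a b ↔ (G.orient I r).Adj a b) := by
    intro a b hI
    constructor
    · exact fun h => .inl (.target h hI)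
    · rintro (h | h)
      · exact h.adj
      · rcases G.skeleton_adj.1 h.1.1 with h' | h'
        · exact h'
        · exact absurd (.target h' hI.symm) h.1.2.2
  refine ⟨⟨hskel, hv⟩, fun S hS => ?_⟩
  obtain ⟨i, hi, rfl⟩ : ∃ i ∈ I, {i} = S := by simpa [atomicInterventions] using hS
  generalize hD : G.orient I r = D at *
  -- Two DAGs with the same skeleton, v-structures and arcs at `i` have the same v-structures
  -- after the intervention at `i`.
  have hmono : ∀ G D : DAG V, G.skeleton = D.skeleton →
      (∀ u v w, G.IsVStructure u v w ↔ D.IsVStructure u v w) →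
      (∀ a b, a ∈ I ∨ b ∈ I → (G.Adj a b ↔ D.Adj a b)) →
      (G.doGraph {i}).skeleton = (D.doGraph {i}).skeleton →
      ∀ u v w, (G.doGraph {i}).IsVStructure u v w → (D.doGraph {i}).IsVStructure u v w := by
    intro G D hskel hv hagree hdo u v w h
    obtain ⟨⟨huv, hvi⟩, ⟨hwv, -⟩, hne, hn⟩ := h
    rw [Finset.mem_singleton] at hvi
    have hn' := hn
    rw [hdo] at hn'
    by_cases hadj : G.skeleton.Adj u w
    · -- The edge between `u` and `w` was removed, so one of them is `i`.
      have hD : ∀ x y, x = i → G.Adj y x → G.Adj x v → G.Adj y v → D.Adj y v := by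
        rintro x y rfl hyx hxv hyv
        refine D.adj_trans_of_skeleton ((hagree y x (.inr hi)).1 hyx)
          ((hagree x v (.inl hi)).1 hxv) ?_
        rw [← hskel]
        exact G.skeleton_adj.2 (.inl hyv)
      rcases G.skeleton_adj.1 hadj with huw | hwu
      · have hwi : w = i := by
          by_contra hwi
          exact hn (skeleton_adj _ |>.2 (.inl ⟨huw, by simpa using hwi⟩))
        exact ⟨⟨hD w u hwi huw hwv huv, by simpa using hvi⟩,
          ⟨(hagree w v (.inl (hwi ▸ hi))).1 hwv, by simpa using hvi⟩, hne, hn'⟩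
      · have hui : u = i := by
          by_contra hui
          exact hn (skeleton_adj _ |>.2 (.inr ⟨hwu, by simpa using hui⟩))
        exact ⟨⟨(hagree u v (.inl (hui ▸ hi))).1 huv, by simpa using hvi⟩,
          ⟨hD u w hui hwu huv hwv, by simpa using hvi⟩, hne, hn'⟩
    · obtain ⟨h1, h2, -, -⟩ := (hv u v w).1 ⟨huv, hwv, hne, hadj⟩
      exact ⟨⟨h1, by simpa using hvi⟩, ⟨h2, by simpa using hvi⟩, hne, hn'⟩
  have hdo : (G.doGraph {i}).skeleton = (D.doGraph {i}).skeleton := by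
    ext a b
    have hs : G.Adj a b ∨ G.Adj b a ↔ D.Adj a b ∨ D.Adj b a := by
      rw [← skeleton_adj, ← skeleton_adj, hskel]
    simp only [skeleton_adj, doGraph, Finset.mem_singleton]
    by_cases ha : a = i
    · have h1 := hagree a b (.inl (ha ▸ hi))
      have h2 := hagree b a (.inr (ha ▸ hi))
      tauto
    · by_cases hb : b = i
      · have h1 := hagree a b (.inr (hb ▸ hi))
        have h2 := hagree b a (.inl (hb ▸ hi))
        tauto
      · tauto
  exact ⟨hdo, fun u v w => ⟨hmono G D hskel hv hagree hdo u v w,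
    hmono D G hskel.symm (fun u v w => (hv u v w).symm) (fun a b h => (hagree a b h).symm)
      hdo.symm u v w⟩⟩

/-- Completeness: an undecided edge takes each direction in the interventional class. -/
theorem exists_adj_of_undecided [Finite V] {G : DAG V} {I : Finset V} {u v : V}
    (h : (G.undecided I).Adj u v) :
    ∃ D ∈ G.interventionalClass (atomicInterventions I), D.Adj u v := by
  have := Fintype.ofFinite V
  obtain ⟨r, hinj, hperf, hfirst⟩ := (G.undecided I).exists_perfect_rank (by
    intro t ht
    obtain ⟨z, hz, hsink⟩ := G.exists_sink ht
    refine ⟨z, hz, fun u hu w hw huz hwz hne => ?_⟩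
    exact undecided_adj_of_parents huz hwz ((G.skeleton_adj.1 huz.1).resolve_right (hsink u hu))
      ((G.skeleton_adj.1 hwz.1).resolve_right (hsink w hw)) hne)
    Finset.univ {u} (Finset.subset_univ _) (by
      intro x hx y hy hne
      simp_all)
  refine ⟨G.orient I r, G.orient_mem_interventionalClass I (fun x y e => hinj x (by simp) y
    (by simp) e) (fun a b c => hperf a (by simp) b (by simp) c (by simp)), .inr ⟨h, ?_⟩⟩
  exact hfirst u (by simp) v (by simp) (by simpa using h.ne.symm)

theorem essentialGraph_edges [Finite V] (G : DAG V) (I : Finset V) :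
    (G.essentialGraph (atomicInterventions I)).edges = G.undecided I := by
  ext u v
  constructor
  · rintro ⟨⟨D, hD, huv⟩, D', hD', hvu⟩
    refine ⟨?_, fun h => D'.asymm _ _ hvu (h.sound hD'), fun h => D.asymm _ _ huv (h.sound hD)⟩
    rw [hD.1.1]
    exact D.skeleton_adj.2 (.inl huv)
  · intro h
    exact ⟨exists_adj_of_undecided h, exists_adj_of_undecided h.symm⟩

/-! ### Disjoint covered arcs in the chain components -/

open Classical in
/-- The parents of `v` in `G` along undecided edges. -/
noncomputable def undecidedParents [Fintype V] (G : DAG V) (I : Finset V) (v : V) : Finset V :=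
  Finset.univ.filter fun u => (G.undecided I).Adj u v ∧ G.Adj u v

theorem mem_undecidedParents [Fintype V] {G : DAG V} {I : Finset V} {u v : V} :
    u ∈ G.undecidedParents I v ↔ (G.undecided I).Adj u v ∧ G.Adj u v := by
  simp [undecidedParents]

theorem meekArc_or_undecided {G : DAG V} (I : Finset V) {u v : V} (h : G.Adj u v) :
    G.MeekArc I u v ∨ (G.undecided I).Adj u v := by
  by_cases h1 : G.MeekArc I u v
  · exact .inl h1
  · exact .inr ⟨G.skeleton_adj.2 (.inl h), h1, fun h2 => G.asymm _ _ h h2.adj⟩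

/-- Let `u` be the last parent of `v` along undecided edges. The other such parents of `v` are
parents of `u`, so `v` has at most one more than `u`; if it has one more, `u → v` is covered. -/
theorem exists_last_undecidedParent [Fintype V] (G : DAG V) (I : Finset V) {v : V}
    (hv : (G.undecidedParents I v).Nonempty) :
    ∃ u ∈ G.undecidedParents I v,
      (G.undecidedParents I v).card ≤ (G.undecidedParents I u).card + 1 ∧
      ((G.undecidedParents I u).card + 1 ≤ (G.undecidedParents I v).card → G.IsCovered u v) := by
  classical
  obtain ⟨u, hu, hlast⟩ := G.exists_sink hv
  have hu' := mem_undecidedParents.1 hu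
  have hsub : (G.undecidedParents I v).erase u ⊆ G.undecidedParents I u := by
    intro x hx
    obtain ⟨hne, hx⟩ := Finset.mem_erase.1 hx
    have hx' := mem_undecidedParents.1 hx
    have hxu := undecided_adj_of_parents hx'.1 hu'.1 hx'.2 hu'.2 hne
    exact mem_undecidedParents.2
      ⟨hxu, (G.skeleton_adj.1 hxu.1).resolve_right (hlast x hx)⟩
  have hcard := Finset.card_erase_add_one hu
  refine ⟨u, hu, ?_, fun hle => ⟨hu'.2, fun a => ?_⟩⟩
  · have := Finset.card_le_card hsub
    omega
  · have heq := Finset.eq_of_subset_of_card_le hsub (by omega)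
    constructor
    · intro hav
      by_cases hau : a = u
      · exact .inr hau
      rcases meekArc_or_undecided I hav with h | h
      · exact .inl (h.of_undecided hu'.1.symm).adj
      · have : a ∈ G.undecidedParents I u :=
          hsub (Finset.mem_erase.2 ⟨hau, mem_undecidedParents.2 ⟨h, hav⟩⟩)
        exact .inl (mem_undecidedParents.1 this).2
    · rintro (hau | rfl)
      · rcases meekArc_or_undecided I hau with h | h
        · exact (h.of_undecided hu'.1).adj
        · have : a ∈ (G.undecidedParents I v).erase u :=
            heq ▸ mem_undecidedParents.2 ⟨h, hau⟩
          exact (mem_undecidedParents.1 (Finset.mem_of_mem_erase this)).2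
      · exact hu'.2

/-- A discrete intermediate value argument: the number of parents along undecided edges grows by
at most one from the last such parent of a vertex to the vertex, hence every value is crossed at
a covered arc of the component. -/
theorem exists_isCovered_card [Fintype V] (G : DAG V) (I : Finset V) (j : ℕ)
    (H : (G.undecided I).ConnectedComponent)
    (hH : ∃ v, (G.undecided I).connectedComponentMk v = H ∧ j < (G.undecidedParents I v).card) :
    ∃ u v, G.IsCovered u v ∧ (G.undecided I).connectedComponentMk u = H ∧
      (G.undecided I).connectedComponentMk v = H ∧
      (G.undecidedParents I u).card = j ∧ (G.undecidedParents I v).card = j + 1 := by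
  classical
  obtain ⟨v, hv, hfirst⟩ := G.exists_source (t := Finset.univ.filter fun v =>
    (G.undecided I).connectedComponentMk v = H ∧ j < (G.undecidedParents I v).card) (by
      obtain ⟨v, hv⟩ := hH
      exact ⟨v, by simpa using hv⟩)
  simp only [Finset.mem_filter, Finset.mem_univ, true_and] at hv hfirst
  obtain ⟨u, hu, hle, hcov⟩ := G.exists_last_undecidedParent I
    (Finset.card_pos.1 (Nat.zero_lt_of_lt hv.2))
  have hu' := mem_undecidedParents.1 hu
  have huH : (G.undecided I).connectedComponentMk u = H :=
    (SimpleGraph.ConnectedComponent.connectedComponentMk_eq_of_adj hu'.1).trans hv.1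
  have hlt : ¬ j < (G.undecidedParents I u).card := fun h => hfirst u ⟨huH, h⟩ hu'.2
  exact ⟨u, v, hcov (by omega), huH, hv.1, by omega, by omega⟩

/-- The last vertex of a largest clique of a component has all others as parents. -/
theorem exists_cliqueNum_le_card [Fintype V] (G : DAG V) (I : Finset V)
    (H : (G.undecided I).ConnectedComponent) :
    ∃ v, (G.undecided I).connectedComponentMk v = H ∧
      H.toSimpleGraph.cliqueNum ≤ (G.undecidedParents I v).card + 1 := by
  classical
  obtain ⟨s, hs⟩ := H.toSimpleGraph.exists_isNClique_cliqueNum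
  rcases s.eq_empty_or_nonempty with rfl | hne
  · obtain ⟨v, hv⟩ := H.nonempty_supp
    refine ⟨v, hv, ?_⟩
    rw [← hs.card_eq]
    simp
  obtain ⟨v, hv, hsink⟩ := G.exists_sink (t := s.map (Function.Embedding.subtype _)) (by simpa)
  have hsub : (s.map (Function.Embedding.subtype _)).erase v ⊆ G.undecidedParents I v := by
    intro x hx
    obtain ⟨hxv, hx⟩ := Finset.mem_erase.1 hx
    have hadj : (G.undecided I).Adj x v := by
      obtain ⟨x', hx', rfl⟩ := Finset.mem_map.1 hx
      obtain ⟨v', hv', rfl⟩ := Finset.mem_map.1 hv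
      exact hs.isClique hx' hv' fun e => hxv (by rw [e])
    exact mem_undecidedParents.2 ⟨hadj, (G.skeleton_adj.1 hadj.1).resolve_right (hsink x hx)⟩
  refine ⟨v, ?_, ?_⟩
  · obtain ⟨v', -, rfl⟩ := Finset.mem_map.1 hv
    exact v'.2
  · have h1 := Finset.card_le_card hsub
    have h2 := Finset.card_erase_add_one hv
    rw [Finset.card_map, hs.card_eq] at h2
    omega

/-- The covered arcs at the levels `2 * j` and `2 * j + 1` of the components are disjoint, and a
verifying set of interventions of size at most one has to meet them all. -/
theorem sum_cliqueNum_le_card [Fintype V] (G : DAG V) (I : Finset V)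
    [Fintype (G.undecided I).ConnectedComponent] {J : Finset (Finset V)}
    (hcard : ∀ S ∈ J, S.card ≤ 1) (hJ : G.IsVerifyingSet J) :
    ∑ H : (G.undecided I).ConnectedComponent, H.toSimpleGraph.cliqueNum / 2 ≤ J.card := by
  classical
  have key : ∀ p : (H : (G.undecided I).ConnectedComponent) × Fin (H.toSimpleGraph.cliqueNum / 2),
      ∃ w, {w} ∈ J ∧ (G.undecided I).connectedComponentMk w = p.1 ∧
        (G.undecidedParents I w).card / 2 = p.2 := by
    rintro ⟨H, j⟩
    obtain ⟨z, hz, hzc⟩ := G.exists_cliqueNum_le_card I H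
    have hj := j.2
    obtain ⟨u, v, hcov, huH, hvH, hu, hv⟩ :=
      G.exists_isCovered_card I (2 * j) H ⟨z, hz, by omega⟩
    obtain ⟨S, hS, hmem⟩ := hJ.exists_mem_of_isCovered hcov
    have hsing : ∀ x ∈ S, {x} ∈ J := fun x hx => by
      rwa [← Finset.eq_of_subset_of_card_le (Finset.singleton_subset_iff.2 hx)
        (by simpa using hcard S hS)] at hS
    rcases hmem with hx | hx
    · exact ⟨u, hsing u hx, huH, by dsimp only; omega⟩
    · exact ⟨v, hsing v hx, hvH, by dsimp only; omega⟩
  choose w hwJ hwH hwc using key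
  have hinj : Function.Injective fun p => (⟨{w p}, hwJ p⟩ : J) := by
    rintro ⟨H, j⟩ ⟨H', j'⟩ h
    have hw : w ⟨H, j⟩ = w ⟨H', j'⟩ := by simpa using h
    have h1 := hwH ⟨H, j⟩
    have h2 := hwH ⟨H', j'⟩
    have h3 := hwc ⟨H, j⟩
    have h4 := hwc ⟨H', j'⟩
    rw [hw] at h1 h3
    obtain rfl : H = H' := h1.symm.trans h2
    obtain rfl : j = j' := Fin.ext (h3.symm.trans h4)
    rfl
  simpa using Fintype.card_le_of_injective _ hinj

end DAG

theorem mainTheorem9 {V : Type*} [Fintype V] (Gstar G : DAG V) (hG : G ∈ Gstar.markovClass) :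
    (Finset.univ.sup fun I : Finset V =>
      ∑ H : (G.essentialGraph (atomicInterventions I)).ChainComponent,
        H.toSimpleGraph.cliqueNum / 2) ≤ G.verificationNumber 1 := by
  refine Finset.sup_le fun I _ => ?_
  -- The infimum is attained, since the set of all singletons is verifying.
  obtain ⟨J, hcard, hJ, hJm⟩ := Nat.sInf_mem (s := {m | ∃ J : Finset (Finset V),
    (∀ S ∈ J, S.card ≤ 1) ∧ G.IsVerifyingSet J ∧ J.card = m})
    ⟨_, atomicInterventions Finset.univ, by
      intro S hS
      obtain ⟨i, -, rfl⟩ := Finset.mem_map.1 hS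
      simp, G.isVerifyingSet_singletons, rfl⟩
  rw [DAG.verificationNumber, ← hJm]
  have hsum : ∀ (U : SimpleGraph V) (_ : U = G.undecided I) [Fintype U.ConnectedComponent],
      ∑ H : U.ConnectedComponent, H.toSimpleGraph.cliqueNum / 2 ≤ J.card := by
    rintro U rfl _
    exact G.sum_cliqueNum_le_card I hcard hJ
  exact hsum _ (G.essentialGraph_edges I)
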